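/- Structures are finite with nonempty universe, vocabularies are finite and relational, and a generalized quantifier of vocabulary $\tau=\{R_1,\dots,R_m\}$ is given by an isomorphism-closed class $\mathcal K$ of $\tau$-structures. For $\tau$-structures $\mathfrak A,\mathfrak B$ with the same universe, $\mathfrak A\le\mathfrak B$ means $R^{\mathfrak A}\subseteq R^{\mathfrak B}$ for all $R\in\tau$; $Q_{\mathcal K}$ is downwards monotone if $\mathfrak A\le\mathfrak B\in\mathcal K$ implies $\mathfrak A\in\mathcal K$. For $\ell\ge 3$ and a finite set $A$ let $n^\ell_A\colon A^\ell\to A$ be the partial function with $n^\ell_A(a_1,\dots,a_\ell)=a$ if and only if $|\{i : a_i=a\}|\ge \ell-1$ (undefined if there is no such $a$). For a $\tau$-structure $\mathfrak B$ with universe $A$ let $n^\ell_A(\mathfrak B)$ be the $\tau$-structure with universe $A$ in which each $R\in\tau$ is interpreted by the set of all tuples that are obtained by applying $n^\ell_A$ componentwise to $\ell$ tuples of $R^{\mathfrak B}$ (with a defined value in every component). The quantifier $Q_{\mathcal K}$ is $\mathcal N_\ell$-closed if, for all $\mathfrak A,\mathfrak B$ with common universe $A$, $\mathfrak B\in\mathcal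 K$ and $R^{\mathfrak A}\subseteq R^{n^\ell_A(\mathfrak B)}\cup R^{\mathfrak B}$ for all $R\in\tau$ imply $\mathfrak A\in\mathcal K$. Let $\mathbf Q_{\mathcal N_\ell}$ be the class of all $\mathcal N_\ell$-closed quantifiers. Let $L^{\omega}_{\infty\omega}(\mathbf Q)$ be the extension by the quantifiers in $\mathbf Q$ of the infinitary logic (first-order logic with arbitrary conjunctions and disjunctions) in which every formula uses only finitely many variables; a formula $Q_{\mathcal K}\,\vec y_1,\dots,\vec y_m(\psi_1,\dots,\psi_m)$, where each $\vec y_i$ is a tuple of $\mathrm{ar}(R_i)$ distinct variables that is bound in $\psi_i$, holds in $\mathfrak A$ under $\alpha$ if the structure with universe $A$ and relations $\{\vec b : (\mathfrak A,\alpha[\vec b/\vec y_i])\models\psi_i\}$, $1\le i\le m$, is in $\mathcal K$. A quantifier is definable in this logic if its class $\mathcal K$ is the class of all models of some sentence of the logic. Let $\mathfrak C_\ell$ be the structure with universe $\{0,1\}$ and the two $\ell$-ary relations $R_c=\{(b_1,\dots,b_\ell) : \sum_i b_i\equiv c \pmod 2\}$, $c=0,1$, and let $\mathsf{CSP}(\mathfrak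 C_\ell)$ be the class of all structures that have a homomorphism to $\mathfrak C_\ell$. **Theorem.** For every $\ell\ge 3$, $\mathbf Q_{\mathcal N_\ell}\subseteq \mathbf Q_{\mathcal N_{\ell+1}}$, and there is a quantifier in $\mathbf Q_{\mathcal N_{\ell+1}}$ which is not definable in $L^{\omega}_{\infty\omega}(\mathbf Q_{\mathcal N_\ell})$: namely, the quantifier $Q_{\mathsf{CSP}(\mathfrak C_\ell)}$ is downwards monotone and $\mathcal N_{\ell+1}$-closed, but it is not definable in $L^{\omega}_{\infty\omega}(\mathbf Q_{\mathcal N_\ell})$. -/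

import Mathlib

universe u

/-- A finite relational vocabulary: finitely many relation symbols, each with an arity. -/
structure Vocabulary where
  Sym : Type
  finite_sym : Finite Sym
  ar : Sym → ℕ

/-- A structure of vocabulary `τ` with universe `A`: each symbol `R` is interpreted by a relation
`R ⊆ A ^ ar R`.  The order `𝔄 ≤ 𝔅` is inclusion of all relations and `𝔄 ⊔ 𝔅` is the union of all
relations (both are the pointwise operations). -/
abbrev RelStr (τ : Vocabulary) (A : Type) : Type :=
  ∀ R : τ.Sym, Set (Fin (τ.ar R) → A)

/-- `h` is a homomorphism from `𝔄` to `𝔅`. -/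
def RelStr.IsHom {τ : Vocabulary} {A B : Type} (𝔄 : RelStr τ A) (𝔅 : RelStr τ B)
    (h : A → B) : Prop :=
  ∀ (R : τ.Sym) (a : Fin (τ.ar R) → A), a ∈ 𝔄 R → h ∘ a ∈ 𝔅 R

/-- The bijection `e` is an isomorphism from `𝔄` to `𝔅`. -/
def RelStr.IsIso {τ : Vocabulary} {A B : Type} (𝔄 : RelStr τ A) (𝔅 : RelStr τ B)
    (e : A ≃ B) : Prop :=
  ∀ (R : τ.Sym) (a : Fin (τ.ar R) → A), a ∈ 𝔄 R ↔ e ∘ a ∈ 𝔅 R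

/-- A generalized (Lindström) quantifier of vocabulary `τ`, given by its defining class: an
isomorphism-closed class of finite `τ`-structures with nonempty universe. -/
structure GenQuantifier (τ : Vocabulary) where
  mem : ∀ {A : Type} [Finite A] [Nonempty A], RelStr τ A → Prop
  mem_of_iso : ∀ {A B : Type} [Finite A] [Nonempty A] [Finite B] [Nonempty B]
    (𝔄 : RelStr τ A) (𝔅 : RelStr τ B) (e : A ≃ B), 𝔄.IsIso 𝔅 e → mem 𝔄 → mem 𝔅

/-- A collection of generalized quantifiers, of arbitrary finite vocabularies. -/
abbrev QuantifierClass : Type 1 := ∀ τ : Vocabulary, Set (GenQuantifier τ)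

/-! ### Families of partial functions and closure conditions -/

/-- A family of `n`-ary partial functions: a partial function `p_A : A ^ n → A` for every finite
set `A`. -/
abbrev PartialFamily (n : ℕ) : Type 1 := ∀ (A : Type) [Finite A], (Fin n → A) →. A

/-- `p(R)`: the set of all tuples obtained by applying the partial function `p` componentwise to
`n` tuples of `R`, whenever the result is defined in every component. -/
def applyRel {A : Type} {n r : ℕ} (p : (Fin n → A) →. A) (R : Set (Fin r → A)) :
    Set (Fin r → A) :=
  {c | ∃ t : Fin n → (Fin r → A), (∀ i, t i ∈ R) ∧ ∀ j, c j ∈ p (fun i => t i j)}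

/-- `p(𝔄)`: apply `p` to every relation of `𝔄`. -/
def applyStr {τ : Vocabulary} {A : Type} {n : ℕ} (p : (Fin n → A) →. A) (𝔄 : RelStr τ A) :
    RelStr τ A :=
  fun R => applyRel p (𝔄 R)

/-- `Q` is `P`-closed: if `𝔅` is in the class and `𝔄 ≤ p_A(𝔅) ∪ 𝔅`, then `𝔄` is in the class. -/
def GenQuantifier.IsClosed {τ : Vocabulary} (Q : GenQuantifier τ) {n : ℕ}
    (P : PartialFamily n) : Prop :=
  ∀ {A : Type} [Finite A] [Nonempty A] (𝔄 𝔅 : RelStr τ A),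
    Q.mem 𝔅 → 𝔄 ≤ applyStr (P A) 𝔅 ⊔ 𝔅 → Q.mem 𝔄

/-- The class of all `P`-closed quantifiers. -/
def closedQuantifiers {n : ℕ} (P : PartialFamily n) : QuantifierClass :=
  fun _ => {Q | Q.IsClosed P}

/-- `Q` is downwards monotone. -/
def GenQuantifier.DownwardsMonotone {τ : Vocabulary} (Q : GenQuantifier τ) : Prop :=
  ∀ {A : Type} [Finite A] [Nonempty A] (𝔄 𝔅 : RelStr τ A), Q.mem 𝔅 → 𝔄 ≤ 𝔅 → Q.mem 𝔄

/-- The family of `ℓ`-ary partial near-unanimity functions (used for `ℓ ≥ 3`): the value at `a` is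
`b` when at least `ℓ - 1` components of `a` equal `b`, and it is undefined when there is no such
`b`; see `mem_nearUnanimity`. -/
noncomputable def nearUnanimity (ℓ : ℕ) : PartialFamily ℓ :=
  fun A _ a => ⟨∃ b : A, ℓ - 1 ≤ {i | a i = b}.ncard, fun h => h.choose⟩

theorem mem_nearUnanimity {ℓ : ℕ} (hℓ : 3 ≤ ℓ) {A : Type} [Finite A] (a : Fin ℓ → A) (b : A) :
    b ∈ nearUnanimity ℓ A a ↔ ℓ - 1 ≤ {i | a i = b}.ncard := by
  have key : ∀ b c : A, ℓ - 1 ≤ {i | a i = b}.ncard → ℓ - 1 ≤ {i | a i = c}.ncard → b = c := by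
    intro b c hb hc
    by_contra hbc
    have hd : Disjoint {i | a i = b} {i | a i = c} := by
      rw [Set.disjoint_left]
      intro i h1 h2
      exact hbc (h1.symm.trans h2)
    have h1 := Set.ncard_union_eq hd
    have h2 := Set.ncard_le_card ({i | a i = b} ∪ {i | a i = c})
    simp only [Nat.card_eq_fintype_card, Fintype.card_fin] at h2
    omega
  constructor
  · rintro ⟨h, rfl⟩
    exact h.choose_spec
  · intro hb
    have h : ∃ b : A, ℓ - 1 ≤ {i | a i = b}.ncard := ⟨b, hb⟩
    exact ⟨h, key _ _ h.choose_spec hb⟩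

/-! ### Infinitary logic with finitely many variables and generalized quantifiers -/

/-- Formulas of vocabulary `σ` of the `k`-variable infinitary logic extended by the quantifiers in
`𝒬`; the variables are the elements of `Fin k`.  Conjunctions range over arbitrary index types, and
disjunction and the universal quantifier are expressed with negation.  In `quant Q y ψ`, for every
symbol `R` of the vocabulary of `Q`, the tuple `y R` of distinct variables is bound in `ψ R`. -/
inductive Formula (𝒬 : QuantifierClass) (σ : Vocabulary) (k : ℕ) : Type (u + 1)
  | eq (x y : Fin k) : Formula 𝒬 σ k
  | rel (R : σ.Sym) (x : Fin (σ.ar R) → Fin k) : Formula 𝒬 σ k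
  | neg (φ : Formula 𝒬 σ k) : Formula 𝒬 σ k
  | conj (ι : Type u) (φ : ι → Formula 𝒬 σ k) : Formula 𝒬 σ k
  | ex (x : Fin k) (φ : Formula 𝒬 σ k) : Formula 𝒬 σ k
  | quant {τ : Vocabulary} (Q : GenQuantifier τ) (hQ : Q ∈ 𝒬 τ)
      (y : ∀ R : τ.Sym, Fin (τ.ar R) ↪ Fin k) (ψ : τ.Sym → Formula 𝒬 σ k) : Formula 𝒬 σ k

namespace Formula

variable {𝒬 : QuantifierClass} {σ : Vocabulary} {k : ℕ}

/-- The set of free variables. -/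
def freeVars : Formula.{u} 𝒬 σ k → Set (Fin k)
  | eq x y => {x, y}
  | rel _ x => Set.range x
  | neg φ => φ.freeVars
  | conj _ φ => ⋃ i, (φ i).freeVars
  | ex x φ => φ.freeVars \ {x}
  | quant _ _ y ψ => ⋃ R, (ψ R).freeVars \ Set.range (y R)

/-- `φ.Sat 𝔄 α`: the formula `φ` holds in `𝔄` under the assignment `α`.  The assignment
`Function.extend y b α` is `α[b/y]`. -/
def Sat {A : Type} [Finite A] [Nonempty A] (𝔄 : RelStr σ A) :
    Formula.{u} 𝒬 σ k → (Fin k → A) → Prop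
  | eq x y, α => α x = α y
  | rel R x, α => (fun j => α (x j)) ∈ 𝔄 R
  | neg φ, α => ¬ φ.Sat 𝔄 α
  | conj _ φ, α => ∀ i, (φ i).Sat 𝔄 α
  | ex x φ, α => ∃ a : A, φ.Sat 𝔄 (Function.update α x a)
  | quant Q _ y ψ, α => Q.mem (fun R => {b | (ψ R).Sat 𝔄 (Function.extend (y R) b α)})

end Formula

/-- The quantifier `K` is definable in the infinitary logic with finitely many variables extended
by the quantifiers in `𝒬`: for some `k` there is a `k`-variable sentence whose class of finite
models is the defining class of `K`. -/
def GenQuantifier.DefinableIn {σ : Vocabulary} (K : GenQuantifier σ) (𝒬 : QuantifierClass) :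
    Prop :=
  ∃ (k : ℕ) (φ : Formula.{u} 𝒬 σ k), φ.freeVars = ∅ ∧
    ∀ {A : Type} [Finite A] [Nonempty A] (𝔄 : RelStr σ A),
      K.mem 𝔄 ↔ ∀ α : Fin k → A, φ.Sat 𝔄 α

/-! ### Constraint satisfaction problems -/

/-- The quantifier of the constraint satisfaction problem with template `ℭ`: the class of all
finite structures that have a homomorphism to `ℭ`. -/
def cspQuantifier {τ : Vocabulary} {C : Type} (ℭ : RelStr τ C) : GenQuantifier τ where
  mem := fun {A} _ _ 𝔄 => ∃ h : A → C, 𝔄.IsHom ℭ h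
  mem_of_iso := by
    rintro A B _ _ _ _ 𝔄 𝔅 e he ⟨h, hh⟩
    refine ⟨h ∘ e.symm, fun R b hb => ?_⟩
    have h1 : e.symm ∘ b ∈ 𝔄 R := by
      rw [he R]
      simpa [← Function.comp_assoc] using hb
    exact hh R _ h1

/-- The vocabulary with two `ℓ`-ary relation symbols, named by the elements of `ZMod 2`. -/
def parityVocabulary (ℓ : ℕ) : Vocabulary where
  Sym := ZMod 2
  finite_sym := inferInstance
  ar := fun _ => ℓ

/-- The structure with universe `{0, 1}` and relations
`R_c = {(b_1, …, b_ℓ) | b_1 + ⋯ + b_ℓ ≡ c mod 2}` for `c = 0, 1`. -/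
def parityStructure (ℓ : ℕ) : RelStr (parityVocabulary ℓ) (ZMod 2) :=
  fun c => {b : Fin ℓ → ZMod 2 | ∑ i, b i = c}

/-! The positive half is counting. A near-unanimous vote of `ℓ + 1` stays near-unanimous when one
voter is dropped, so `ℓ`-closure is the stronger condition. On `ℓ`-ary relations the `ℓ + 1` vote
adds nothing (`applyRel_nearUnanimity_arity_succ_subset`), so downward monotonicity suffices for the
CSP quantifier.

Undefinability is a Cai–Fürer–Immerman argument. Put a mod 2 variable on each edge of an `ℓ`-regular
bipartite graph on a torus and prescribe the sum at every vertex. The all-zero system is solvable. A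
system twisted at one vertex is not, since each edge is counted once on the left and once on the
right. Flipping the edges along a path moves a twist from one end of the path to the other, so a
twist can be kept away from `k` pebbles. This yields the back-and-forth invariant `Matches`.

For a quantifier (`Matches.sat`), the twist is first brought to a vertex surrounded by free rows.
From there `ℓ` edge-disjoint paths avoiding the old pebbles lead to a column free of the new ones
(`exists_disjoint_chains`). Flipping a tuple along these paths gives `ℓ` tuples, each matched with a
tuple of the other structure. Each component is changed by at most one path, so near-unanimity
returns the original tuple, and `ℓ`-closure transfers membership. -/

/-! ### Near-unanimity closure -/

theorem applyRel_nearUnanimity_succ_subset {ℓ : ℕ} (hℓ : 3 ≤ ℓ) {A : Type} [Finite A] {r : ℕ}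
    (R : Set (Fin r → A)) :
    applyRel (nearUnanimity (ℓ + 1) A) R ⊆ applyRel (nearUnanimity ℓ A) R := by
  rintro c ⟨t, ht, hc⟩
  refine ⟨fun i => t i.castSucc, fun i => ht _, fun j => ?_⟩
  have h := (mem_nearUnanimity (by omega) _ _).1 (hc j)
  rw [mem_nearUnanimity hℓ]
  have hsub : {i : Fin (ℓ + 1) | t i j = c j} ⊆
      insert (Fin.last ℓ) (Fin.castSucc '' {i : Fin ℓ | t i.castSucc j = c j}) := by
    intro i hi
    induction i using Fin.lastCases with
    | last => exact Or.inl rfl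
    | cast i => exact Or.inr ⟨i, hi, rfl⟩
  have h1 := Set.ncard_le_ncard hsub (Set.toFinite _)
  have h2 := Set.ncard_insert_le (Fin.last ℓ)
    (Fin.castSucc '' {i : Fin ℓ | t i.castSucc j = c j})
  rw [Set.ncard_image_of_injective _ (Fin.castSucc_injective ℓ)] at h2
  change ℓ - 1 ≤ {i : Fin ℓ | t i.castSucc j = c j}.ncard
  omega

/-- Pigeonhole: if all `ℓ + 1` tuples differ from the result, two of them differ from it in the same
one of the `ℓ` coordinates, but only one dissent per coordinate is allowed. -/
theorem applyRel_nearUnanimity_arity_succ_subset {ℓ : ℕ} (hℓ : 3 ≤ ℓ) {A : Type} [Finite A]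
    (R : Set (Fin ℓ → A)) :
    applyRel (nearUnanimity (ℓ + 1) A) R ⊆ R := by
  rintro c ⟨t, ht, hc⟩
  by_contra hcR
  have hne : ∀ i, ∃ j, t i j ≠ c j := by
    intro i
    by_contra! h
    exact hcR (funext h ▸ ht i)
  choose f hf using hne
  obtain ⟨i, i', hii', hff⟩ := Fintype.exists_ne_map_eq_of_card_lt f (by simp)
  have h := (mem_nearUnanimity (by omega) _ _).1 (hc (f i))
  have hsub : ({i, i'} : Set (Fin (ℓ + 1))) ⊆ {a | t a (f i) = c (f i)}ᶜ := by
    rintro a (rfl | rfl)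
    · exact hf _
    · rw [hff]; exact hf _
  have h1 := Set.ncard_le_ncard hsub (Set.toFinite _)
  rw [Set.ncard_pair hii'] at h1
  have h2 := Set.ncard_add_ncard_compl {a | t a (f i) = c (f i)}
  simp only [Nat.card_eq_fintype_card, Fintype.card_fin] at h2
  omega

theorem closedQuantifiers_nearUnanimity_subset {ℓ : ℕ} (hℓ : 3 ≤ ℓ) (τ : Vocabulary) :
    closedQuantifiers (nearUnanimity ℓ) τ ⊆ closedQuantifiers (nearUnanimity (ℓ + 1)) τ := by
  intro Q hQ A _ _ 𝔄 𝔅 h𝔅 hle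
  exact hQ 𝔄 𝔅 h𝔅 fun R => (hle R).trans
    (Set.union_subset_union_left _ (applyRel_nearUnanimity_succ_subset hℓ (𝔅 R)))

theorem cspQuantifier_downwardsMonotone {τ : Vocabulary} {C : Type} (ℭ : RelStr τ C) :
    (cspQuantifier ℭ).DownwardsMonotone := by
  rintro A _ _ 𝔄 𝔅 ⟨h, hh⟩ hle
  exact ⟨h, fun R a ha => hh R a (hle R ha)⟩

theorem cspQuantifier_parityStructure_mem {ℓ : ℕ} (hℓ : 3 ≤ ℓ) :
    cspQuantifier (parityStructure ℓ) ∈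
      closedQuantifiers (nearUnanimity (ℓ + 1)) (parityVocabulary ℓ) := by
  intro A _ _ 𝔄 𝔅 h𝔅 hle
  refine cspQuantifier_downwardsMonotone _ 𝔄 𝔅 h𝔅 fun R a ha => ?_
  rcases hle R ha with h | h
  · exact applyRel_nearUnanimity_arity_succ_subset hℓ (A := A) (𝔅 R) h
  · exact h

/-! ### The bipartite torus graph

The left vertex `g` is adjacent to the right vertex `g + edgeShift n i` by the edge `(g, i)`. -/

/-- Points of the torus. -/
abbrev Torus (n : ℕ) : Type := ZMod n × ZMod n

/-- The displacement of the edges of kind `i`. -/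
def edgeShift (n i : ℕ) : Torus n :=
  if i = 0 then 0 else if i = 1 then (1, 0) else (0, (i : ZMod n) - 1)

/-- The list of the edges at a vertex; left vertices are `Sum.inl g`, right ones `Sum.inr g`. -/
def incidence (n ℓ : ℕ) : Torus n ⊕ Torus n → Fin ℓ → Torus n × Fin ℓ
  | .inl g, i => (g, i)
  | .inr g, i => (g - edgeShift n i, i)

/-- The boundary of a mod 2 chain of edges. -/
def edgeBoundary {n ℓ : ℕ} (S : Torus n × Fin ℓ → ZMod 2) (v : Torus n ⊕ Torus n) : ZMod 2 :=
  ∑ j, S (incidence n ℓ v j)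

/-- The chain of a single left vertex. -/
def leftPoint {n : ℕ} (g : Torus n) : Torus n ⊕ Torus n → ZMod 2 :=
  Pi.single (Sum.inl g) 1

theorem zmod_two_add_self_fun {α : Type*} (f : α → ZMod 2) : f + f = 0 :=
  funext fun _ => CharTwo.add_self_eq_zero _

section Chains

variable {n ℓ : ℕ}

theorem edgeBoundary_add (S T : Torus n × Fin ℓ → ZMod 2) :
    edgeBoundary (S + T) = edgeBoundary S + edgeBoundary T :=
  funext fun _ => Finset.sum_add_distrib

theorem edgeBoundary_zero : edgeBoundary (0 : Torus n × Fin ℓ → ZMod 2) = 0 :=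
  funext fun _ => Finset.sum_const_zero

theorem edgeBoundary_single (g : Torus n) (i : Fin ℓ) :
    edgeBoundary (Pi.single (g, i) 1) =
      leftPoint g + Pi.single (Sum.inr (g + edgeShift n i)) 1 := by
  funext v
  rcases v with h | h
  · simp only [edgeBoundary, incidence, leftPoint, Pi.add_apply, Pi.single_apply, Prod.mk.injEq,
      Sum.inl.injEq, reduceCtorEq, if_false, add_zero]
    by_cases hg : h = g <;> simp [hg]
  · simp only [edgeBoundary, incidence, leftPoint, Pi.add_apply, Pi.single_apply, Prod.mk.injEq,
      Sum.inr.injEq, reduceCtorEq, if_false, zero_add]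
    rw [Finset.sum_eq_single i]
    · simp [sub_eq_iff_eq_add]
    · intro j _ hj; simp [hj]
    · simp

/-- A path of two edges between left vertices. -/
theorem edgeBoundary_hop (g : Torus n) (i j : Fin ℓ) (g' : Torus n)
    (h : g' + edgeShift n j = g + edgeShift n i) :
    edgeBoundary (Pi.single (g, i) 1 + Pi.single (g', j) 1) = leftPoint g + leftPoint g' := by
  rw [edgeBoundary_add, edgeBoundary_single, edgeBoundary_single, h, add_add_add_comm,
    zmod_two_add_self_fun, add_zero]

theorem leftPoint_trans (a b c : Torus n) :
    leftPoint a + leftPoint b + (leftPoint b + leftPoint c) = leftPoint a + leftPoint c := by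
  rw [add_assoc, ← add_assoc (leftPoint b), zmod_two_add_self_fun, zero_add]

theorem eq_of_single_ne_zero {e e' : Torus n × Fin ℓ}
    (h : (Pi.single e 1 : Torus n × Fin ℓ → ZMod 2) e' ≠ 0) : e' = e := by
  by_contra hne
  exact h (by simp [hne])

theorem add_ne_zero_cases {e : Torus n × Fin ℓ} {p q : Torus n × Fin ℓ → ZMod 2}
    (h : (p + q) e ≠ 0) : p e ≠ 0 ∨ q e ≠ 0 := by
  by_contra! h'
  exact h (by simp [h'.1, h'.2])

/-- Edges of kinds 1 and 0 alternate along the row. The initial edge of kind 0 is excluded because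
another of the disjoint paths will leave the starting vertex through it. -/
theorem exists_row_chain [NeZero n] (hℓ : 3 ≤ ℓ) (x c y : ZMod n) :
    ∃ p : Torus n × Fin ℓ → ZMod 2, edgeBoundary p = leftPoint (x, y) + leftPoint (c, y) ∧
      ∀ e, p e ≠ 0 → e.1.2 = y ∧ (e.2 : ℕ) < 2 ∧ e ≠ ((x, y), ⟨0, by omega⟩) := by
  -- The bound `t < n` keeps the path from wrapping around to its starting vertex.
  have key : ∀ t : ℕ, t < n → ∃ p : Torus n × Fin ℓ → ZMod 2,
      edgeBoundary p = leftPoint (x, y) + leftPoint (x + (t : ZMod n), y) ∧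
      ∀ e, p e ≠ 0 → e.1.2 = y ∧ (e.2 : ℕ) < 2 ∧ e ≠ ((x, y), ⟨0, by omega⟩) := by
    intro t
    induction t with
    | zero =>
      intro _
      refine ⟨0, ?_, fun e he => absurd rfl he⟩
      rw [edgeBoundary_zero, Nat.cast_zero, add_zero, zmod_two_add_self_fun]
    | succ t ih =>
      intro ht
      obtain ⟨p, hp, hs⟩ := ih (by omega)
      refine ⟨p + (Pi.single ((x + t, y), ⟨1, by omega⟩) 1 +
        Pi.single ((x + (t + 1 : ℕ), y), ⟨0, by omega⟩) 1), ?_, ?_⟩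
      · rw [edgeBoundary_add, hp, edgeBoundary_hop, leftPoint_trans]
        simp [edgeShift, add_assoc]
      · intro e he
        rcases add_ne_zero_cases he with he | he
        · exact hs e he
        rcases add_ne_zero_cases he with he | he
        · obtain rfl := eq_of_single_ne_zero he
          simp
        · obtain rfl := eq_of_single_ne_zero he
          refine ⟨rfl, by simp, fun h => ?_⟩
          simp only [Prod.mk.injEq, and_true, add_eq_left] at h
          rw [ZMod.natCast_eq_zero_iff] at h
          exact absurd (Nat.le_of_dvd (by omega) h) (by omega)
  obtain ⟨p, hp⟩ := key (c - x).val (ZMod.val_lt _)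
  rw [ZMod.natCast_zmod_val, add_sub_cancel] at hp
  exact ⟨p, hp⟩

theorem exists_column_chain [NeZero n] (hℓ : 3 ≤ ℓ) (x y d : ZMod n) :
    ∃ p : Torus n × Fin ℓ → ZMod 2, edgeBoundary p = leftPoint (x, y) + leftPoint (x, d) ∧
      ∀ e, p e ≠ 0 → e.1.1 = x := by
  have key : ∀ t : ℕ, ∃ p : Torus n × Fin ℓ → ZMod 2,
      edgeBoundary p = leftPoint (x, y) + leftPoint (x, y + (t : ZMod n)) ∧ ∀ e, p e ≠ 0 → e.1.1 = x := by
    intro t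
    induction t with
    | zero =>
      refine ⟨0, ?_, fun e he => absurd rfl he⟩
      rw [edgeBoundary_zero, Nat.cast_zero, add_zero, zmod_two_add_self_fun]
    | succ t ih =>
      obtain ⟨p, hp, hs⟩ := ih
      refine ⟨p + (Pi.single ((x, y + t), ⟨2, by omega⟩) 1 +
        Pi.single ((x, y + (t + 1 : ℕ)), ⟨0, by omega⟩) 1), ?_, ?_⟩
      · rw [edgeBoundary_add, hp, edgeBoundary_hop, leftPoint_trans]
        simp [edgeShift, add_assoc]
        norm_num
      · intro e he
        rcases add_ne_zero_cases he with he | he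
        · exact hs e he
        rcases add_ne_zero_cases he with he | he <;>
        · obtain rfl := eq_of_single_ne_zero he
          rfl
  obtain ⟨p, hp⟩ := key (d - y).val
  rw [ZMod.natCast_zmod_val, add_sub_cancel] at hp
  exact ⟨p, hp⟩

/-- Two left vertices in columns that avoid `X` are joined by a path that avoids `X`. -/
theorem exists_avoiding_chain [NeZero n] (hℓ : 3 ≤ ℓ) (X : Finset (Torus n)) (hX : X.card < n)
    (v w : Torus n) (hv : v.1 ∉ X.image Prod.fst) (hw : w.1 ∉ X.image Prod.fst) :
    ∃ p : Torus n × Fin ℓ → ZMod 2, edgeBoundary p = leftPoint v + leftPoint w ∧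
      ∀ e, e.1 ∈ X → p e = 0 := by
  obtain ⟨r, hr⟩ : ∃ r, r ∉ X.image Prod.snd := by
    refine (Finset.exists_mem_notMem_of_card_lt_card (t := Finset.univ) ?_).imp fun _ h => h.2
    rw [Finset.card_univ, ZMod.card]
    exact Finset.card_image_le.trans_lt hX
  -- Down the free column of `v`, along the free row `r`, then up the free column of `w`.
  obtain ⟨p, hp, hps⟩ := exists_column_chain hℓ v.1 v.2 r
  obtain ⟨q, hq, hqs⟩ := exists_row_chain hℓ v.1 w.1 r
  obtain ⟨s, hs, hss⟩ := exists_column_chain hℓ w.1 r w.2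
  refine ⟨p + q + s, ?_, fun e he => ?_⟩
  · rw [edgeBoundary_add, edgeBoundary_add, hp, hq, hs, leftPoint_trans, leftPoint_trans]
  · by_contra h
    rcases add_ne_zero_cases h with h | h
    · rcases add_ne_zero_cases h with h | h
      · exact hv (hps e h ▸ Finset.mem_image_of_mem _ he)
      · exact hr ((hqs e h).1 ▸ Finset.mem_image_of_mem _ he)
    · exact hw (hss e h ▸ Finset.mem_image_of_mem _ he)

/-- Disjoint paths from `v`, one for each edge at `v`, to left vertices of the column `c`. -/
theorem exists_disjoint_chains [NeZero n] (hℓ : 3 ≤ ℓ) (hn : ℓ ≤ n) (X : Finset (Torus n))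
    (v : Torus n) (hv : v.1 ∉ X.image Prod.fst)
    (hr : ∀ i : Fin ℓ, v.2 + ((i : ℕ) - 1 : ZMod n) ∉ X.image Prod.snd) (c : ZMod n) :
    ∃ p : Fin ℓ → Torus n × Fin ℓ → ZMod 2,
      (∀ i : Fin ℓ, edgeBoundary (p i) =
        leftPoint v + leftPoint (c, v.2 + ((i : ℕ) - 1 : ZMod n))) ∧
      (∀ i e, e.1 ∈ X → p i e = 0) ∧ ∀ i i' e, p i e ≠ 0 → p i' e ≠ 0 → i = i' := by
  -- Path `i` leaves `v` by edge `i` and continues in row `v.2 + i - 1`; these rows are distinct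
  -- since `ℓ ≤ n`. Path 1 stays in the row of `v`, path 0 drops one row through an edge of kind 2,
  -- and every other path climbs directly to its row. The disjunction lists the possible edges:
  -- those in the row, the first edge, and the extra edge of path 0.
  have key : ∀ i : Fin ℓ, ∃ p : Torus n × Fin ℓ → ZMod 2,
      edgeBoundary p = leftPoint v + leftPoint (c, v.2 + ((i : ℕ) - 1 : ZMod n)) ∧
      ∀ e, p e ≠ 0 →
        (e.1.2 = v.2 + ((i : ℕ) - 1 : ZMod n) ∧ (e.2 : ℕ) < 2 ∧ e ≠ (v, ⟨0, by omega⟩)) ∨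
        (e = (v, i) ∧ (i : ℕ) ≠ 1) ∨
        ((i : ℕ) = 0 ∧ e = ((v.1, v.2 - 1), ⟨2, by omega⟩)) := by
    intro i
    obtain ⟨q, hq, hqs⟩ := exists_row_chain hℓ v.1 c (v.2 + ((i : ℕ) - 1 : ZMod n))
    have h10 : (1 : ZMod n) ≠ 0 := by
      have : Fact (1 < n) := ⟨by omega⟩
      exact one_ne_zero
    have hrow : (i : ℕ) ≠ 1 → v.2 + ((i : ℕ) - 1 : ZMod n) ≠ v.2 := by
      intro h1 h
      rw [add_eq_left, sub_eq_zero, ← Nat.cast_one, ZMod.natCast_eq_natCast_iff',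
        Nat.mod_eq_of_lt (by omega), Nat.mod_eq_of_lt (by omega)] at h
      exact h1 h
    have hqs' : ∀ e, q e ≠ 0 → e.1.2 = v.2 + ((i : ℕ) - 1 : ZMod n) ∧ (e.2 : ℕ) < 2 ∧
        e ≠ (v, ⟨0, by omega⟩) := by
      intro e he
      refine ⟨(hqs e he).1, (hqs e he).2.1, ?_⟩
      by_cases h1 : (i : ℕ) = 1
      · have := (hqs e he).2.2
        simpa [h1] using this
      · rintro rfl
        exact hrow h1 (hqs _ he).1.symm
    by_cases h0 : (i : ℕ) = 0
    · refine ⟨Pi.single (v, i) 1 + Pi.single ((v.1, v.2 - 1), ⟨2, by omega⟩) 1 + q, ?_, ?_⟩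
      · have hi : v.2 + ((i : ℕ) - 1 : ZMod n) = v.2 - 1 := by rw [h0]; simp [sub_eq_add_neg]
        rw [hi] at hq ⊢
        rw [edgeBoundary_add, hq, edgeBoundary_hop, leftPoint_trans]
        ext <;> simp [edgeShift, h0]
        norm_num
      · intro e he
        rcases add_ne_zero_cases he with he | he
        · rcases add_ne_zero_cases he with he | he
          · exact Or.inr (Or.inl ⟨eq_of_single_ne_zero he, by omega⟩)
          · exact Or.inr (Or.inr ⟨h0, eq_of_single_ne_zero he⟩)
        · exact Or.inl (hqs' e he)
    by_cases h1 : (i : ℕ) = 1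
    · refine ⟨q, ?_, fun e he => Or.inl (hqs' e he)⟩
      simpa [h1] using hq
    · refine ⟨Pi.single (v, i) 1 +
        Pi.single ((v.1, v.2 + ((i : ℕ) - 1 : ZMod n)), ⟨0, by omega⟩) 1 + q, ?_, ?_⟩
      · rw [edgeBoundary_add, hq, edgeBoundary_hop, leftPoint_trans]
        ext <;> simp [edgeShift, h0, h1]
      · intro e he
        rcases add_ne_zero_cases he with he | he
        · rcases add_ne_zero_cases he with he | he
          · exact Or.inr (Or.inl ⟨eq_of_single_ne_zero he, h1⟩)
          · obtain rfl := eq_of_single_ne_zero he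
            refine Or.inl ⟨rfl, by simp, fun h => hrow h1 ?_⟩
            exact congrArg (fun e => e.1.2) h
        · exact Or.inl (hqs' e he)
  choose p hp hps using key
  refine ⟨p, hp, fun i e he => ?_, fun i i' e h h' => ?_⟩
  · by_contra h
    rcases hps i e h with h | h | h
    · exact hr i (h.1 ▸ Finset.mem_image_of_mem _ he)
    · exact hv (by rw [h.1] at he; exact Finset.mem_image_of_mem _ he)
    · exact hv (Finset.mem_image.2 ⟨_, he, by rw [h.2]⟩)
  · have h10 : (1 : ZMod n) ≠ 0 := by
      have : Fact (1 < n) := ⟨by omega⟩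
      exact one_ne_zero
    rcases hps i e h with ⟨a1, a2, a3⟩ | ⟨rfl, a2⟩ | ⟨a1, rfl⟩ <;>
    rcases hps i' _ h' with ⟨b1, b2, b3⟩ | ⟨b1, b2⟩ | ⟨b1, b2⟩
    · rw [a1, add_right_inj, sub_left_inj, ZMod.natCast_eq_natCast_iff',
        Nat.mod_eq_of_lt (by omega), Nat.mod_eq_of_lt (by omega)] at b1
      exact Fin.ext b1
    · subst b1
      have hi : i' = ⟨0, by omega⟩ := Fin.ext (by simp at a2 ⊢; omega)
      exact absurd (congrArg (Prod.mk v) hi) a3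
    · subst b2
      simp at a2
    · have hi : i = ⟨0, by omega⟩ := Fin.ext (by simp at b2 ⊢; omega)
      exact absurd (congrArg (Prod.mk v) hi) b3
    · exact congrArg Prod.snd b1
    · have := congrArg (fun e => e.1.2) b2
      exact absurd (sub_eq_self.1 this.symm) h10
    · simp at b2
    · have := congrArg (fun e => e.1.2) b1
      exact absurd (sub_eq_self.1 this) h10
    · exact Fin.ext (a1.trans b1.symm)

end Chains

/-! ### Twisted parity systems -/

/-- The parity system over the torus graph with right-hand sides `u`, made homogeneous by doubling
every variable. -/
def twistedSystem {n ℓ : ℕ} (u : Torus n ⊕ Torus n → ZMod 2) :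
    RelStr (parityVocabulary ℓ) ((Torus n × Fin ℓ) × ZMod 2) :=
  fun c => {t : Fin ℓ → (Torus n × Fin ℓ) × ZMod 2 |
    ∃ v, (∀ j, (t j).1 = incidence n ℓ v j) ∧ ∑ j, (t j).2 = (show ZMod 2 from c) + u v}

/-- Flip the copies of the edges of a chain. -/
def flipEdges {E : Type} (S : E → ZMod 2) (a : E × ZMod 2) : E × ZMod 2 :=
  (a.1, a.2 + S a.1)

theorem flipEdges_flipEdges {E : Type} (S T : E → ZMod 2) (a : E × ZMod 2) :
    flipEdges S (flipEdges T a) = flipEdges (S + T) a := by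
  simp only [flipEdges, Pi.add_apply]
  rw [add_assoc, add_comm (T a.1)]

theorem flipEdges_self {E : Type} (S : E → ZMod 2) (a : E × ZMod 2) :
    flipEdges S (flipEdges S a) = a := by
  rw [flipEdges_flipEdges, zmod_two_add_self_fun]
  simp [flipEdges]

theorem flipEdges_of_eq_zero {E : Type} {S : E → ZMod 2} {a : E × ZMod 2} (h : S a.1 = 0) :
    flipEdges S a = a := by
  simp [flipEdges, h]

/-- `flipEdges S` as a permutation. -/
def flipEquiv {E : Type} (S : E → ZMod 2) : E × ZMod 2 ≃ E × ZMod 2 where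
  toFun := flipEdges S
  invFun := flipEdges S
  left_inv := flipEdges_self S
  right_inv := flipEdges_self S

theorem twistedSystem_zero_mem {n ℓ : ℕ} [NeZero n] [NeZero ℓ] :
    (cspQuantifier (parityStructure ℓ)).mem (twistedSystem (n := n) (ℓ := ℓ) 0) := by
  refine ⟨Prod.snd, ?_⟩
  rintro c t ⟨v, -, hv⟩
  exact hv.trans (add_zero _)

/-- A homomorphism restricted to the zero copies of the edges would be a chain with boundary
`leftPoint w`, whose total is odd; by bipartiteness the total of any boundary is even. -/
theorem twistedSystem_leftPoint_notMem {n ℓ : ℕ} [NeZero n] [NeZero ℓ] (w : Torus n) :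
    ¬ (cspQuantifier (parityStructure ℓ)).mem (twistedSystem (ℓ := ℓ) (leftPoint w)) := by
  rintro ⟨h, hh⟩
  have key : ∀ v, edgeBoundary (fun e : Torus n × Fin ℓ => h (e, 0)) v = leftPoint w v := by
    intro v
    refine hh (leftPoint w v) (fun j => (incidence n ℓ v j, 0)) ⟨v, fun j => rfl, ?_⟩
    rw [CharTwo.add_self_eq_zero]
    exact Finset.sum_const_zero
  have hsum : ∑ v, edgeBoundary (fun e : Torus n × Fin ℓ => h (e, 0)) v = 1 := by
    rw [Finset.sum_congr rfl fun v _ => key v]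
    simp [leftPoint]
  rw [Fintype.sum_sum_type] at hsum
  have h2 : ∑ g : Torus n, edgeBoundary (fun e : Torus n × Fin ℓ => h (e, 0)) (Sum.inr g) =
      ∑ g : Torus n, edgeBoundary (fun e : Torus n × Fin ℓ => h (e, 0)) (Sum.inl g) := by
    simp only [edgeBoundary, incidence]
    rw [Finset.sum_comm, Finset.sum_comm (s := Finset.univ) (t := Finset.univ)
      (f := fun (g : Torus n) (j : Fin ℓ) => h ((g, j), 0))]
    exact Finset.sum_congr rfl fun j _ =>
      Equiv.sum_comp (Equiv.subRight (edgeShift n j)) fun g => h ((g, j), 0)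
  rw [h2, CharTwo.add_self_eq_zero] at hsum
  exact zero_ne_one hsum

/-! ### The pebble game invariant -/

section Game

variable {n ℓ k : ℕ}

/-- The torus points of the edges that are pebbled by an assignment. -/
def pebbled (α : Fin k → (Torus n × Fin ℓ) × ZMod 2) : Finset (Torus n) :=
  Finset.univ.image fun x => (α x).1.1

theorem card_pebbled_le (α : Fin k → (Torus n × Fin ℓ) × ZMod 2) : (pebbled α).card ≤ k :=
  Finset.card_image_le.trans (by simp)

theorem mem_pebbled (α : Fin k → (Torus n × Fin ℓ) × ZMod 2) (x : Fin k) :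
    (α x).1.1 ∈ pebbled α :=
  Finset.mem_image_of_mem (fun x => (α x).1.1) (Finset.mem_univ x)

/-- The chain `S` matches `α` with `β`, up to a single twist at the left vertex `v`, whose column
is not pebbled. -/
structure Matches (u u' : Torus n ⊕ Torus n → ZMod 2)
    (α β : Fin k → (Torus n × Fin ℓ) × ZMod 2) (S : Torus n × Fin ℓ → ZMod 2) (v : Torus n) :
    Prop where
  map : ∀ x, β x = flipEdges S (α x)
  boundary : edgeBoundary S = u + u' + leftPoint v
  column : v.1 ∉ (pebbled α).image Prod.fst

variable {u u' : Torus n ⊕ Torus n → ZMod 2} {α β : Fin k → (Torus n × Fin ℓ) × ZMod 2}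
  {S : Torus n × Fin ℓ → ZMod 2} {v : Torus n}

theorem Matches.pebbled_eq (h : Matches u u' α β S v) : pebbled β = pebbled α := by
  simp only [pebbled, h.map, flipEdges]

theorem Matches.symm (h : Matches u u' α β S v) : Matches u' u β α S v where
  map x := by rw [h.map, flipEdges_self]
  boundary := by rw [h.boundary, add_comm u]
  column := by rw [h.pebbled_eq]; exact h.column

/-- Change the chain along a path from `v` to `w` which avoids the pebbles, and then the pebbles. -/
theorem Matches.move (h : Matches u u' α β S v) {p : Torus n × Fin ℓ → ZMod 2} {w : Torus n}
    (hp : edgeBoundary p = leftPoint v + leftPoint w) (hpα : ∀ e, e.1 ∈ pebbled α → p e = 0)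
    {α' β' : Fin k → (Torus n × Fin ℓ) × ZMod 2}
    (hmap : ∀ x, (α' x = α x ∧ β' x = β x) ∨ β' x = flipEdges (S + p) (α' x))
    (hw : w.1 ∉ (pebbled α').image Prod.fst) : Matches u u' α' β' (S + p) w where
  map x := by
    rcases hmap x with ⟨h1, h2⟩ | h1
    · rw [h1, h2, h.map, ← flipEdges_flipEdges, flipEdges_of_eq_zero (hpα _ (mem_pebbled α x))]
    · exact h1
  boundary := by
    rw [edgeBoundary_add, h.boundary, hp, add_assoc (u + u'), ← add_assoc (leftPoint v),
      zmod_two_add_self_fun, zero_add]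
  column := hw

theorem exists_free_column [NeZero n] (X : Finset (Torus n)) (hX : X.card < n) :
    ∃ c, c ∉ X.image Prod.fst := by
  refine (Finset.exists_mem_notMem_of_card_lt_card (t := Finset.univ) ?_).imp fun _ h => h.2
  rw [Finset.card_univ, ZMod.card]
  exact Finset.card_image_le.trans_lt hX

theorem exists_free_rows [NeZero n] (ℓ : ℕ) (X : Finset (Torus n)) (hX : X.card * ℓ < n) :
    ∃ y : ZMod n, ∀ i : Fin ℓ, y + ((i : ℕ) - 1 : ZMod n) ∉ X.image Prod.snd := by
  obtain ⟨y, -, hy⟩ := Finset.exists_mem_notMem_of_card_lt_card (t := Finset.univ)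
    (s := (X ×ˢ (Finset.univ : Finset (Fin ℓ))).image
      fun q => q.1.2 - ((q.2 : ℕ) - 1 : ZMod n)) (by
        rw [Finset.card_univ, ZMod.card]
        refine Finset.card_image_le.trans_lt ?_
        simpa [Finset.card_product] using hX)
  refine ⟨y, fun i hi => hy ?_⟩
  obtain ⟨g, hg, hgi⟩ := Finset.mem_image.1 hi
  exact Finset.mem_image.2 ⟨(g, i), by simp [hg], by simp [hgi]⟩

/-- A tuple of the relation pebbles all edges at its vertex, and every edge at the twisted vertex
`v` lies in the unpebbled column; so the tuple sits at a vertex where `S` has the correct boundary.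
-/
theorem Matches.sat_rel (hℓ : 3 ≤ ℓ) (h : Matches u u' α β S v)
    (R : (parityVocabulary ℓ).Sym) (x : Fin ℓ → Fin k)
    (hα : (fun j => α (x j)) ∈ twistedSystem u R) : (fun j => β (x j)) ∈ twistedSystem u' R := by
  obtain ⟨w, hw, hs⟩ := hα
  refine ⟨w, fun j => by simpa [h.map, flipEdges] using hw j, ?_⟩
  have hne : w ≠ Sum.inl v := by
    rintro rfl
    apply h.column
    have := mem_pebbled α (x ⟨0, by omega⟩)
    rw [hw] at this
    exact Finset.mem_image_of_mem Prod.fst this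
  have key : ∀ a b c : ZMod 2, a + b + (b + c) = a + c := by decide
  have hb := congrFun h.boundary w
  simp only [edgeBoundary, ← hw] at hb
  simp only [h.map, flipEdges, Finset.sum_add_distrib, hs, hb, leftPoint, Pi.add_apply,
    Pi.single_eq_of_ne hne, add_zero]
  exact key R (u w) (u' w)

/-- Formulas of the logic with `nearUnanimity ℓ`-closed quantifiers are preserved. -/
theorem Matches.sat [NeZero n] [NeZero ℓ] (hℓ : 3 ≤ ℓ) (hn : (k + 1) * ℓ ≤ n)
    (φ : Formula.{u} (closedQuantifiers (nearUnanimity ℓ)) (parityVocabulary ℓ) k) :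
    ∀ {u u' : Torus n ⊕ Torus n → ZMod 2} {α β : Fin k → (Torus n × Fin ℓ) × ZMod 2}
      {S : Torus n × Fin ℓ → ZMod 2} {v : Torus n}, Matches u u' α β S v →
      φ.Sat (twistedSystem u) α → φ.Sat (twistedSystem u') β := by
  -- Each of at most `k` pebbles blocks at most `ℓ` choices of the central row.
  have hkn : k * ℓ < n := by rw [add_mul] at hn; omega
  have hk : k < n := (Nat.le_mul_of_pos_right k (by omega)).trans_lt hkn
  have hℓn : ℓ ≤ n := (Nat.le_mul_of_pos_left ℓ (by omega)).trans hn
  induction φ with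
  | eq x y =>
    intro u u' α β S v h hs
    simp only [Formula.Sat] at hs ⊢
    rw [h.map, h.map, hs]
  | rel R x =>
    intro u u' α β S v h hs
    exact h.sat_rel hℓ R x hs
  | neg φ ih =>
    intro u u' α β S v h hs hs'
    exact hs (ih h.symm hs')
  | conj ι φ ih =>
    intro u u' α β S v h hs i
    exact ih i h (hs i)
  | ex x φ ih =>
    rintro u u' α β S v h ⟨a, ha⟩
    obtain ⟨c, hc⟩ := exists_free_column (pebbled (Function.update α x a))
      ((card_pebbled_le _).trans_lt hk)
    obtain ⟨x₀, hx₀⟩ := exists_free_column (pebbled α) ((card_pebbled_le α).trans_lt hk)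
    obtain ⟨r, hr⟩ := exists_free_rows ℓ (pebbled α)
      ((Nat.mul_le_mul_right ℓ (card_pebbled_le α)).trans_lt hkn)
    obtain ⟨q, hq, hqα⟩ := exists_avoiding_chain hℓ (pebbled α)
      ((card_pebbled_le α).trans_lt hk) v (x₀, r) h.column hx₀
    have h' := h.move hq hqα (fun x => Or.inl ⟨rfl, rfl⟩) hx₀
    -- Column `c` may still contain the old pebble on `x`, so `exists_avoiding_chain` does not
    -- apply; any one of the disjoint paths, here path 0, reaches it.
    obtain ⟨p, hp, hpα, -⟩ := exists_disjoint_chains hℓ hℓn (pebbled α) (x₀, r) hx₀ hr c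
    refine ⟨flipEdges (S + q + p 0) a, ih (h'.move (hp 0) (hpα 0) (fun z => ?_) hc) ha⟩
    by_cases hz : z = x
    · subst hz
      right
      simp
    · left
      simp [hz]
  | @quant τ Q hQ y ψ ih =>
    intro u u' α β S₀ v₀ h₀ hs
    obtain ⟨x, hx⟩ := exists_free_column (pebbled α) ((card_pebbled_le α).trans_lt hk)
    obtain ⟨r, hr⟩ := exists_free_rows ℓ (pebbled α)
      ((Nat.mul_le_mul_right ℓ (card_pebbled_le α)).trans_lt hkn)
    obtain ⟨q, hq, hqα⟩ := exists_avoiding_chain hℓ (pebbled α)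
      ((card_pebbled_le α).trans_lt hk) v₀ (x, r) h₀.column hx
    have h := h₀.move hq hqα (fun x => Or.inl ⟨rfl, rfl⟩) hx
    set S := S₀ + q
    -- Transport along the flip by `S`, so that both structures given to the quantifier can be
    -- compared on the same elements.
    have hs' := Q.mem_of_iso _ (fun R => {b | (ψ R).Sat (twistedSystem u)
      (Function.extend (y R) (flipEdges S ∘ b) α)}) (flipEquiv S) (fun R a => by
        have : flipEdges S ∘ (flipEquiv S) ∘ a = a := funext fun j => flipEdges_self S (a j)
        simp [this]) hs
    refine hQ _ _ hs' fun R b hb => Or.inl ?_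
    -- The destination depends on the tuple `b`; the center `(x, r)` and the chain `S` do not, as
    -- the transported structure must be fixed in advance.
    obtain ⟨c, hc⟩ := exists_free_column (pebbled (Function.extend (y R) b β))
      ((card_pebbled_le _).trans_lt hk)
    obtain ⟨p, hp, hpα, hdis⟩ := exists_disjoint_chains hℓ hℓn (pebbled α) (x, r) hx hr c
    refine ⟨fun i => flipEdges (p i) ∘ b, fun i => ?_, fun j => ?_⟩
    · have hm := h.symm.move (hp i) (by rw [h.pebbled_eq]; exact hpα i)
        (α' := Function.extend (y R) b β)
        (β' := Function.extend (y R) (flipEdges S ∘ flipEdges (p i) ∘ b) α) (fun z => by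
          by_cases hz : ∃ j, y R j = z
          · obtain ⟨j, rfl⟩ := hz
            right
            rw [(y R).injective.extend_apply, (y R).injective.extend_apply]
            exact flipEdges_flipEdges _ _ _
          · left
            rw [Function.extend_apply' _ _ _ hz, Function.extend_apply' _ _ _ hz]
            exact ⟨rfl, rfl⟩) hc
      exact ih R hm hb
    · rw [mem_nearUnanimity hℓ]
      have hsub : {i | (flipEdges (p i) ∘ b) j = b j}ᶜ.Subsingleton := by
        intro i hi i' hi'
        exact hdis i i' (b j).1 (fun h0 => hi (flipEdges_of_eq_zero h0))
          (fun h0 => hi' (flipEdges_of_eq_zero h0))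
      have h1 := (Set.ncard_le_one_iff_subsingleton).2 hsub
      have h2 := Set.ncard_add_ncard_compl {i | (flipEdges (p i) ∘ b) j = b j}
      simp only [Nat.card_eq_fintype_card, Fintype.card_fin] at h2
      simp only [Function.comp_apply] at h1 h2 ⊢
      omega

end Game

/-! ### Undefinability and conclusion -/

theorem cspQuantifier_parityStructure_not_definableIn {ℓ : ℕ} (hℓ : 3 ≤ ℓ) :
    ¬ (cspQuantifier (parityStructure ℓ)).DefinableIn.{u}
      (closedQuantifiers (nearUnanimity ℓ)) := by
  rintro ⟨k, φ, -, hφ⟩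
  obtain ⟨n, hn⟩ : ∃ n, n = (k + 1) * ℓ := ⟨_, rfl⟩
  have : NeZero ℓ := ⟨by omega⟩
  have : NeZero n := ⟨by rw [hn]; exact (Nat.mul_pos (by omega) (by omega)).ne'⟩
  have hk : k < n := by
    have := Nat.le_mul_of_pos_right (k + 1) (show 0 < ℓ by omega)
    omega
  refine twistedSystem_leftPoint_notMem (n := n) (ℓ := ℓ) (0, 0) ((hφ _).2 fun β => ?_)
  obtain ⟨c, hc⟩ := exists_free_column (pebbled β) ((card_pebbled_le β).trans_lt hk)
  -- The two systems differ by a twist at `(0, 0)`; this path carries it to a column not pebbled by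
  -- `β`.
  obtain ⟨p, hp, -⟩ := exists_row_chain (n := n) hℓ 0 c 0
  have hm : Matches (leftPoint (0, 0)) 0 β (fun x => flipEdges p (β x)) p (c, 0) :=
    ⟨fun _ => rfl, by rw [hp, add_zero], hc⟩
  exact hm.symm.sat hℓ hn.ge φ ((hφ _).1 twistedSystem_zero_mem _)

theorem mainTheorem3 (ℓ : ℕ) (hℓ : 3 ≤ ℓ) :
    (∀ τ : Vocabulary,
      closedQuantifiers (nearUnanimity ℓ) τ ⊆ closedQuantifiers (nearUnanimity (ℓ + 1)) τ) ∧
    (cspQuantifier (parityStructure ℓ)).DownwardsMonotone ∧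
    cspQuantifier (parityStructure ℓ) ∈
      closedQuantifiers (nearUnanimity (ℓ + 1)) (parityVocabulary ℓ) ∧
    ¬ (cspQuantifier (parityStructure ℓ)).DefinableIn.{u} (closedQuantifiers (nearUnanimity ℓ)) :=
  ⟨closedQuantifiers_nearUnanimity_subset hℓ, cspQuantifier_downwardsMonotone _,
    cspQuantifier_parityStructure_mem hℓ, cspQuantifier_parityStructure_not_definableIn hℓ⟩
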